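/- Let $R$ be a ring with identity. A unital twisted partial action of $\mathbb Z$ on $R$ is a triple $\alpha=(\{D_i\}_{i\in\mathbb Z},\{\alpha_i\}_{i\in\mathbb Z},\{w_{i,j}\}_{i,j\in\mathbb Z})$, where $D_i$ is a two-sided ideal of $R$ generated by a central idempotent $1_i$, $\alpha_i:D_{-i}\to D_i$ is a ring isomorphism, and $w_{i,j}$ is an invertible element of the ring $D_iD_{i+j}$ (with identity $1_i1_{i+j}$), such that for all $i,j,k\in\mathbb Z$: $D_0=R$ and $\alpha_0=\mathrm{id}_R$; $\alpha_i(D_{-i}D_j)=D_iD_{i+j}$; $\alpha_i(\alpha_j(a))=w_{i,j}\,\alpha_{i+j}(a)\,w_{i,j}^{-1}$ for $a\in D_{-j}D_{-(i+j)}$; $w_{i,0}=w_{0,i}=1_i$; and $\alpha_i(a w_{j,k})w_{i,j+k}=\alpha_i(a)w_{i,j}w_{i+j,k}$ for $a\in D_{-i}D_jD_{j+k}$. The ring $R[[x;\alpha,w]]$ consists of the formal series $\sum_{n\ge 0}a_nx^n$ with $a_n\in D_n$, with coefficientwise addition and the multiplication given by $(ax^i)(bx^j)=\alpha_i(\alpha_i^{-1}(a)b)\,w_{i,j}\,x^{i+j}$.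 A twisted global action of $\mathbb Z$ on a (not necessarily unital) associative ring $T$ consists of ring automorphisms $\beta_i$ of $T$ and invertible multipliers $u_{i,j}$ of $T$ such that, for all $i,j,k\in\mathbb Z$ and $a\in T$: $\beta_0=\mathrm{id}_T$; $\beta_i(\beta_j(a))=u_{i,j}\beta_{i+j}(a)u_{i,j}^{-1}$; $u_{i,0}=u_{0,i}=1$; and $\beta_i(au_{j,k})u_{i,j+k}=\beta_i(a)u_{i,j}u_{i+j,k}$. The ring $T[[x;\beta,u]]$ consists of the formal series $\sum_{n\ge0}a_nx^n$ with $a_n\in T$, with $(ax^i)(bx^j)=\beta_i(\beta_i^{-1}(a)b)\,u_{i,j}\,x^{i+j}$. Suppose that $(T,\beta,u)$ is an enveloping action of $(R,\alpha,w)$ via an injective ring homomorphism $\varphi:R\to T$; that is, for all $i,j\in\mathbb Z$: $\varphi(R)$ is a two-sided ideal of $T$; $T=\sum_{i\in\mathbb Z}\beta_i(\varphi(R))$; $\varphi(D_i)=\varphi(R)\cap\beta_i(\varphi(R))$; $\varphi(\alpha_i(a))=\beta_i(\varphi(a))$ for $a\in D_{-i}$; and $\varphi(aw_{i,j})=\varphi(a)u_{i,j}$,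 $\varphi(w_{i,j}a)=u_{i,j}\varphi(a)$ for $a\in D_iD_{i+j}$. Regard $R[[x;\alpha,w]]$ as a subring of $T[[x;\beta,u]]$ via $\sum a_nx^n\mapsto\sum\varphi(a_n)x^n$, and $R$ as the set of constant series $\varphi(r)x^0$. Then the contraction $P'\mapsto P'\cap R[[x;\alpha,w]]$ is a bijection from the set of all prime ideals $P'$ of $T[[x;\beta,u]]$ with $R\not\subseteq P'$ onto the set of all prime ideals of $R[[x;\alpha,w]]$. Here a prime ideal of a ring is a proper two-sided ideal $P$ such that, for two-sided ideals $I,J$, $IJ\subseteq P$ implies $I\subseteq P$ or $J\subseteq P$. -/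

import Mathlib

/-- A unital twisted partial action of `ℤ` on a unital ring `R`: ideals `D i` generated by central
idempotents `e i`, ring isomorphisms `α i : D (-i) → D i`, and elements `w i j` which are invertible
in `D i * D (i + j)` (with inverse `winv i j`). A product of ideals generated by central
idempotents is their intersection, so products `D i * D j` are written as intersections. -/
structure TwistedPartialAction (R : Type*) [Ring R] where
  D : ℤ → TwoSidedIdeal R
  e : ℤ → R
  e_idem : ∀ i, e i * e i = e i
  e_central : ∀ i r, e i * r = r * e i
  D_eq_span : ∀ i, D i = TwoSidedIdeal.span {e i}
  α : ∀ i, D (-i) ≃+* D i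
  w : ℤ → ℤ → R
  winv : ℤ → ℤ → R
  w_mem : ∀ i j, w i j ∈ D i ∧ w i j ∈ D (i + j)
  winv_mem : ∀ i j, winv i j ∈ D i ∧ winv i j ∈ D (i + j)
  w_mul_winv : ∀ i j, w i j * winv i j = e i * e (i + j)
  winv_mul_w : ∀ i j, winv i j * w i j = e i * e (i + j)
  D_zero : D 0 = ⊤
  α_zero : ∀ a : D (-0), (α 0 a : R) = a
  α_image : ∀ i j, (fun a : D (-i) => (α i a : R)) '' {a | (a : R) ∈ D j} =
    {b | b ∈ D i ∧ b ∈ D (i + j)}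
  /-- `α i (α j a) = w i j * α (i + j) a * (w i j)⁻¹` for `a ∈ D (-j) * D (-(i + j))`
  (the membership `h` is automatic). -/
  α_comp : ∀ i j (a : R) (h₁ : a ∈ D (-j)) (h₂ : a ∈ D (-(i + j)))
    (h : (α j ⟨a, h₁⟩ : R) ∈ D (-i)),
    (α i ⟨(α j ⟨a, h₁⟩ : R), h⟩ : R) = w i j * (α (i + j) ⟨a, h₂⟩ : R) * winv i j
  w_right_zero : ∀ i, w i 0 = e i
  w_left_zero : ∀ i, w 0 i = e i
  /-- The cocycle identity, for `a ∈ D (-i) * D j * D (j + k)`. -/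
  cocycle : ∀ i j k (a : R) (h : a ∈ D (-i)), a ∈ D j → a ∈ D (j + k) →
    (α i ⟨a * w j k, (D (-i)).mul_mem_right _ _ h⟩ : R) * w i (j + k) =
      (α i ⟨a, h⟩ : R) * w i j * w (i + j) k

namespace TwistedPartialAction

variable {R : Type*} [Ring R] (A : TwistedPartialAction R)

theorem mem_D {i : ℤ} {a : R} : a ∈ A.D i ↔ a * A.e i = a := by
  constructor
  · intro h
    rw [A.D_eq_span] at h
    induction h using TwoSidedIdeal.span_induction with
    | mem x h => rw [Set.mem_singleton_iff.1 h, A.e_idem]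
    | zero => simp
    | add x y _ _ hx hy => rw [add_mul, hx, hy]
    | neg x _ hx => rw [neg_mul, hx]
    | left_absorb a x _ hx => rw [mul_assoc, hx]
    | right_absorb b x _ hx => rw [mul_assoc, ← A.e_central, ← mul_assoc, hx]
  · intro h
    rw [← h, A.D_eq_span]
    exact TwoSidedIdeal.mul_mem_left _ _ _ (TwoSidedIdeal.subset_span rfl)

theorem e_mem (i : ℤ) : A.e i ∈ A.D i := A.mem_D.2 (A.e_idem i)

theorem e_zero : A.e 0 = 1 := by
  have h : (1 : R) ∈ A.D 0 := by rw [A.D_zero]; trivial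
  simpa using A.mem_D.1 h

theorem α_mem {i j : ℤ} {a : A.D (-i)} (h : (a : R) ∈ A.D j) : (A.α i a : R) ∈ A.D (i + j) := by
  have : (A.α i a : R) ∈ {b | b ∈ A.D i ∧ b ∈ A.D (i + j)} := by
    rw [← A.α_image]; exact ⟨a, h, rfl⟩
  exact this.2

/-- The coefficient of `(a x^i) (b x^j)`, namely `α_i (α_i⁻¹ (a) b) w_{i,j}`. -/
def monoMul (i j : ℤ) (a : A.D i) (b : R) : R :=
  (A.α i ⟨((A.α i).symm a : R) * b, (A.D (-i)).mul_mem_right _ _ ((A.α i).symm a).2⟩ : R) * A.w i j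

theorem monoMul_mem (i j : ℤ) (a : A.D i) (b : R) : A.monoMul i j a b ∈ A.D (i + j) :=
  (A.D _).mul_mem_left _ _ (A.w_mem i j).2

/-- The extension `r ↦ α_i (r 1_{-i})` of `α_i` to `R`. -/
def act (i : ℤ) (r : R) : R := (A.α i ⟨A.e (-i) * r, (A.D _).mul_mem_right _ _ (A.e_mem _)⟩ : R)

theorem act_add (i : ℤ) (r s : R) : A.act i (r + s) = A.act i r + A.act i s := by
  unfold act
  rw [← AddMemClass.coe_add, ← map_add]
  congr 3
  simp [mul_add]

theorem act_mul (i : ℤ) (r s : R) : A.act i (r * s) = A.act i r * A.act i s := by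
  unfold act
  rw [← MulMemClass.coe_mul, ← map_mul]
  congr 2
  apply Subtype.ext
  simp only [MulMemClass.coe_mul]
  rw [mul_assoc, ← mul_assoc r, ← A.e_central, ← mul_assoc, ← mul_assoc, ← mul_assoc,
    A.e_idem]

theorem α_eq_act {i : ℤ} (a : A.D (-i)) : (A.α i a : R) = A.act i a := by
  unfold act
  congr 2
  apply Subtype.ext
  simp only
  rw [A.e_central, A.mem_D.1 a.2]

theorem act_mem (i : ℤ) (r : R) : A.act i r ∈ A.D i := (A.α i _).2

theorem act_mem_add (i : ℤ) {j : ℤ} {r : R} (h : r ∈ A.D j) : A.act i r ∈ A.D (i + j) :=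
  A.α_mem ((A.D j).mul_mem_left _ _ h)

theorem monoMul_eq (i j : ℤ) (a : A.D i) (b : R) :
    A.monoMul i j a b = a * A.act i b * A.w i j := by
  unfold monoMul
  rw [α_eq_act, act_mul, ← α_eq_act, RingEquiv.apply_symm_apply]

theorem act_zero' (i : ℤ) : A.act i 0 = 0 := by
  have := A.act_add i 0 0
  simpa using this

theorem act_eq_mul_e (i : ℤ) (r : R) : A.act i (A.e (-i) * r) = A.act i r := by
  unfold act
  congr 3
  rw [← mul_assoc, A.e_idem]

theorem act_comp (i j : ℤ) (c : R) :
    A.act i (A.act j c) * A.w i j = A.w i j * A.act (i + j) c := by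
  have key : ∀ b : R, b ∈ A.D (-j) → b ∈ A.D (-(i + j)) →
      A.act i (A.act j b) * A.w i j = A.w i j * A.act (i + j) b := by
    intro b h₁ h₂
    have h : (A.α j ⟨b, h₁⟩ : R) ∈ A.D (-i) := by
      have := A.α_mem (i := j) (j := -(i + j)) (a := ⟨b, h₁⟩) h₂
      have h' : j + -(i + j) = -i := by ring
      rwa [h'] at this
    have := A.α_comp i j b h₁ h₂ h
    rw [A.α_eq_act, A.α_eq_act, A.α_eq_act] at this
    simp only at this
    rw [this, mul_assoc, A.winv_mul_w]
    have h3 : A.act (i + j) b * A.e i = A.act (i + j) b := by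
      rw [← A.mem_D]
      have := A.act_mem_add (i + j) h₁
      simpa using this
    have h4 := A.mem_D.1 (A.act_mem (i + j) b)
    rw [mul_assoc, ← mul_assoc (A.act (i + j) b), h3, h4]
  have hw1 := A.mem_D.1 (A.w_mem i j).1
  have hw2 := A.mem_D.1 (A.w_mem i j).2
  set b := A.e (-(i + j)) * (A.e (-j) * c) with hb
  have hb2 : b ∈ A.D (-(i + j)) := (A.D _).mul_mem_right _ _ (A.e_mem _)
  have hb1 : b ∈ A.D (-j) := (A.D _).mul_mem_left _ _ ((A.D _).mul_mem_right _ _ (A.e_mem _))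
  have hk := key b hb1 hb2
  -- the image under `α j` of `1_{-j} 1_{-(i+j)}` is `1_j 1_{-i}`
  have him : ∀ k l : ℤ, A.act k (A.e l) = A.e k * A.e (k + l) := by
    intro k l
    have hm1 := A.act_mem k (A.e l)
    have hm2 := A.act_mem_add k (A.e_mem l)
    have : A.e k * A.e (k + l) ∈ {b | b ∈ A.D k ∧ b ∈ A.D (k + l)} :=
      ⟨(A.D _).mul_mem_right _ _ (A.e_mem _), (A.D _).mul_mem_left _ _ (A.e_mem _)⟩
    rw [← A.α_image] at this
    obtain ⟨a, ha, hae⟩ := this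
    simp only at hae
    rw [A.α_eq_act] at hae
    have h1 : A.act k (A.e l) * A.act k a = A.act k a := by
      rw [← A.act_mul, A.e_central, A.mem_D.1 ha]
    rw [hae, ← mul_assoc, A.mem_D.1 hm1, A.mem_D.1 hm2] at h1
    exact h1
  have e1 : A.act i (A.act j b) = A.act i (A.act j c) := by
    rw [hb, A.act_mul j, A.act_eq_mul_e, him]
    have : j + -(i + j) = -i := by ring
    rw [this, mul_assoc, A.e_central j, mul_assoc, A.mem_D.1 (A.act_mem j c), A.act_eq_mul_e]
  have e2 : A.w i j * A.act (i + j) b = A.w i j * A.act (i + j) c := by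
    rw [hb, A.act_eq_mul_e, A.act_mul, him]
    have : i + j + -j = i := by ring
    rw [this, ← mul_assoc, ← mul_assoc, hw2, hw1]
  rw [← e1, hk, e2]

theorem monoMul_assoc (i j k : ℤ) (a : A.D i) (b : A.D j) {c : R} (hc : c ∈ A.D k) (m : A.D (i + j))
    (hm : (m : R) = A.monoMul i j a b) :
    A.monoMul (i + j) k m c = A.monoMul i (j + k) a (A.monoMul j k b c) := by
  rw [monoMul_eq, hm, monoMul_eq, monoMul_eq, monoMul_eq]
  have hx1 : A.e (-i) * ((b : R) * A.act j c) ∈ A.D (-i) :=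
    (A.D _).mul_mem_right _ _ (A.e_mem _)
  have hx2 : A.e (-i) * ((b : R) * A.act j c) ∈ A.D j :=
    (A.D _).mul_mem_left _ _ ((A.D _).mul_mem_right _ _ b.2)
  have hx3 : A.e (-i) * ((b : R) * A.act j c) ∈ A.D (j + k) :=
    (A.D _).mul_mem_left _ _ ((A.D _).mul_mem_left _ _ (A.act_mem_add j hc))
  have := A.cocycle i j k _ hx1 hx2 hx3
  rw [A.α_eq_act, A.α_eq_act] at this
  simp only at this
  rw [A.act_eq_mul_e, mul_assoc (A.e (-i)), A.act_eq_mul_e] at this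
  rw [mul_assoc (a : R) _ (A.w i (j + k)), this, A.act_mul]
  rw [mul_assoc (A.act i _), A.act_comp]
  simp only [mul_assoc]

/-- The underlying additive group of `R[[x; α, w]]`: sequences `(a_n)` with `a_n ∈ D_n`. -/
def seriesSubgroup : AddSubgroup (ℕ → R) where
  carrier := {f | ∀ n : ℕ, f n ∈ A.D n}
  zero_mem' n := (A.D n).zero_mem
  add_mem' hf hg n := (A.D n).add_mem (hf n) (hg n)
  neg_mem' hf n := (A.D n).neg_mem (hf n)

/-- The twisted partial skew power series ring `R[[x; α, w]]`. The element with coefficients `a_n`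
is the series `∑ a_n x^n`. -/
def Series : Type _ := A.seriesSubgroup

instance : AddCommGroup A.Series := inferInstanceAs (AddCommGroup A.seriesSubgroup)

variable {A}

/-- The `n`-th coefficient, an element of `D_n`. -/
def Series.coeff (f : A.Series) (n : ℕ) : A.D n := ⟨f.1 n, f.2 n⟩

theorem Series.ext {f g : A.Series} (h : ∀ n, (f.coeff n : R) = g.coeff n) : f = g :=
  Subtype.ext (funext h)

/-- The series with the given coefficients. -/
def Series.mk (f : ℕ → R) (hf : ∀ n : ℕ, f n ∈ A.D n) : A.Series := ⟨f, hf⟩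

@[simp] theorem Series.coeff_mk (f : ℕ → R) (hf : ∀ n : ℕ, f n ∈ A.D n) (n : ℕ) :
    ((Series.mk f hf).coeff n : R) = f n := rfl

@[simp] theorem Series.coeff_add (f g : A.Series) (n : ℕ) :
    ((f + g).coeff n : R) = f.coeff n + g.coeff n := rfl

@[simp] theorem Series.coeff_zero (n : ℕ) : ((0 : A.Series).coeff n : R) = 0 := rfl

instance : Mul A.Series where
  mul f g := Series.mk
    (fun n => ∑ p ∈ Finset.HasAntidiagonal.antidiagonal n, A.monoMul p.1 p.2 (f.coeff p.1) (g.coeff p.2))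
    (fun n => sum_mem fun p hp => by
      have := A.monoMul_mem p.1 p.2 (f.coeff p.1) (g.coeff p.2)
      rwa [← Nat.cast_add, Finset.HasAntidiagonal.mem_antidiagonal.1 hp] at this)

instance : One A.Series where
  one := Series.mk (fun n => if n = 0 then 1 else 0) (fun n => by
    split_ifs with h
    · subst h
      simp only [Nat.cast_zero]
      rw [A.D_zero]
      trivial
    · exact (A.D n).zero_mem)

theorem Series.coeff_mul (f g : A.Series) (n : ℕ) : ((f * g).coeff n : R) =
    ∑ p ∈ Finset.HasAntidiagonal.antidiagonal n, A.monoMul p.1 p.2 (f.coeff p.1) (g.coeff p.2) := rfl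

theorem Series.coeff_one (n : ℕ) : ((1 : A.Series).coeff n : R) = if n = 0 then 1 else 0 := rfl

theorem act_zero_left (r : R) : A.act 0 r = r := by
  unfold act
  rw [A.α_zero]
  simp only [neg_zero, A.e_zero, one_mul]

theorem act_sum {ι : Type*} (i : ℤ) (s : Finset ι) (f : ι → R) :
    A.act i (∑ x ∈ s, f x) = ∑ x ∈ s, A.act i (f x) :=
  map_sum (⟨⟨A.act i, A.act_zero' i⟩, A.act_add i⟩ : R →+ R) f s

theorem act_one (i : ℤ) : A.act i 1 = A.e i := by
  obtain ⟨a, ha⟩ := (A.α i).surjective ⟨A.e i, A.e_mem i⟩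
  have h2 : A.act i a = A.e i := by rw [← A.α_eq_act, ha]
  have h1 : A.act i 1 * A.act i a = A.act i a := by rw [← A.act_mul, one_mul]
  rw [h2, A.mem_D.1 (A.act_mem i 1)] at h1
  exact h1

instance : Ring A.Series :=
  { (inferInstance : AddCommGroup A.Series) with
    mul := (· * ·)
    one := 1
    left_distrib := fun f g h => Series.ext fun n => by
      simp only [Series.coeff_mul, Series.coeff_add, monoMul_eq, act_add, mul_add, add_mul,
        Finset.sum_add_distrib]
    right_distrib := fun f g h => Series.ext fun n => by
      simp only [Series.coeff_mul, Series.coeff_add, monoMul_eq, add_mul, Finset.sum_add_distrib]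
    zero_mul := fun f => Series.ext fun n => by
      simp [Series.coeff_mul, monoMul_eq]
    mul_zero := fun f => Series.ext fun n => by
      simp [Series.coeff_mul, monoMul_eq, act_zero']
    one_mul := fun f => Series.ext fun n => by
      rw [Series.coeff_mul, Finset.sum_eq_single (0, n)]
      · rw [monoMul_eq, Series.coeff_one]
        simp only [Nat.cast_zero, if_true, one_mul, act_zero_left, A.w_left_zero]
        exact A.mem_D.1 (f.coeff n).2
      · rintro ⟨i, j⟩ hp hne
        have : i ≠ 0 := by
          rintro rfl
          apply hne
          simpa using hp
        rw [monoMul_eq, Series.coeff_one]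
        simp [this]
      · simp
    mul_one := fun f => Series.ext fun n => by
      rw [Series.coeff_mul, Finset.sum_eq_single (n, 0)]
      · rw [monoMul_eq, Series.coeff_one]
        simp only [Nat.cast_zero, if_true, A.w_right_zero, act_one]
        rw [A.mem_D.1 (f.coeff n).2, A.mem_D.1 (f.coeff n).2]
      · rintro ⟨i, j⟩ hp hne
        have : j ≠ 0 := by
          rintro rfl
          apply hne
          simpa using hp
        rw [monoMul_eq, Series.coeff_one]
        simp [this, act_zero']
      · simp
    mul_assoc := fun f g h => Series.ext fun n => by
      have hL : ((f * g * h).coeff n : R) = ∑ p ∈ Finset.HasAntidiagonal.antidiagonal n,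
          ∑ q ∈ Finset.HasAntidiagonal.antidiagonal p.1, A.monoMul q.1 (q.2 + p.2) (f.coeff q.1)
            (A.monoMul q.2 p.2 (g.coeff q.2) (h.coeff p.2)) := by
        rw [Series.coeff_mul]
        refine Finset.sum_congr rfl fun p hp => ?_
        rw [monoMul_eq, Series.coeff_mul, Finset.sum_mul, Finset.sum_mul]
        refine Finset.sum_congr rfl fun q hq => ?_
        have hq' := Finset.HasAntidiagonal.mem_antidiagonal.1 hq
        rw [← A.monoMul_assoc q.1 q.2 p.2 (f.coeff q.1) (g.coeff q.2) (h.coeff p.2).2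
          ⟨_, A.monoMul_mem q.1 q.2 (f.coeff q.1) (g.coeff q.2)⟩ rfl,
          A.monoMul_eq (q.1 + q.2), ← hq', Nat.cast_add]
      have hR : ((f * (g * h)).coeff n : R) = ∑ p ∈ Finset.HasAntidiagonal.antidiagonal n,
          ∑ q ∈ Finset.HasAntidiagonal.antidiagonal p.2, A.monoMul p.1 (q.1 + q.2) (f.coeff p.1)
            (A.monoMul q.1 q.2 (g.coeff q.1) (h.coeff q.2)) := by
        rw [Series.coeff_mul]
        refine Finset.sum_congr rfl fun p hp => ?_
        rw [monoMul_eq, Series.coeff_mul, act_sum, Finset.mul_sum, Finset.sum_mul]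
        refine Finset.sum_congr rfl fun q hq => ?_
        have hq' := Finset.HasAntidiagonal.mem_antidiagonal.1 hq
        rw [A.monoMul_eq p.1, ← hq', Nat.cast_add]
      rw [hL, hR]
      simp only [Finset.sum_sigma']
      apply Finset.sum_nbij' (fun ⟨⟨_i, j⟩, ⟨k, l⟩⟩ ↦ ⟨(k, l + j), (l, j)⟩)
        (fun ⟨⟨i, _j⟩, ⟨k, l⟩⟩ ↦ ⟨(i + k, l), (i, k)⟩)
      · rintro ⟨⟨i, j⟩, ⟨k, l⟩⟩ hp
        simp only [Finset.mem_sigma, Finset.HasAntidiagonal.mem_antidiagonal] at hp ⊢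
        obtain ⟨h1, h2⟩ := hp
        constructor
        · omega
        · trivial
      · rintro ⟨⟨i, j⟩, ⟨k, l⟩⟩ hp
        simp only [Finset.mem_sigma, Finset.HasAntidiagonal.mem_antidiagonal] at hp ⊢
        obtain ⟨h1, h2⟩ := hp
        constructor
        · omega
        · trivial
      · rintro ⟨⟨i, j⟩, ⟨k, l⟩⟩ hp
        simp only [Finset.mem_sigma, Finset.HasAntidiagonal.mem_antidiagonal] at hp
        obtain ⟨h1, rfl⟩ := hp
        rfl
      · rintro ⟨⟨i, j⟩, ⟨k, l⟩⟩ hp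
        simp only [Finset.mem_sigma, Finset.HasAntidiagonal.mem_antidiagonal] at hp
        obtain ⟨h1, rfl⟩ := hp
        rfl
      · rintro ⟨⟨i, j⟩, ⟨k, l⟩⟩ hp
        rfl }

end TwistedPartialAction

/-- A multiplier of a (possibly non-unital) ring `T`: a pair of additive maps, left multiplication
`a ↦ m a` and right multiplication `a ↦ a m`, compatible with the product of `T`. -/
@[ext] structure RingMultiplier (T : Type*) [NonUnitalRing T] where
  left : T →+ T
  right : T →+ T
  left_mul : ∀ a b, left (a * b) = left a * b
  right_mul : ∀ a b, right (a * b) = a * right b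
  central : ∀ a b, right a * b = a * left b

namespace RingMultiplier

variable {T : Type*} [NonUnitalRing T]

/-- Multipliers form a monoid: `(m n) a = m (n a)` and `a (m n) = (a m) n`. -/
instance : Monoid (RingMultiplier T) where
  mul m n :=
    { left := m.left.comp n.left
      right := n.right.comp m.right
      left_mul := fun a b => by simp [left_mul]
      right_mul := fun a b => by simp [right_mul]
      central := fun a b => by simp [central] }
  one :=
    { left := AddMonoidHom.id T
      right := AddMonoidHom.id T
      left_mul := fun _ _ => rfl
      right_mul := fun _ _ => rfl
      central := fun _ _ => rfl }
  mul_assoc _ _ _ := rfl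
  one_mul _ := rfl
  mul_one _ := rfl

theorem mul_left' (m n : RingMultiplier T) (a : T) : (m * n).left a = m.left (n.left a) := rfl
theorem mul_right' (m n : RingMultiplier T) (a : T) : (m * n).right a = n.right (m.right a) := rfl
theorem one_left' (a : T) : (1 : RingMultiplier T).left a = a := rfl
theorem one_right' (a : T) : (1 : RingMultiplier T).right a = a := rfl

end RingMultiplier

/-- A twisted global action of `ℤ` on a (possibly non-unital) ring `T`: automorphisms `β i` and
invertible multipliers `u i j`. -/
structure TwistedGlobalAction (T : Type*) [NonUnitalRing T] where
  β : ℤ → T ≃+* T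
  u : ℤ → ℤ → (RingMultiplier T)ˣ
  β_zero : ∀ a, β 0 a = a
  /-- `β i (β j a) = u i j * β (i + j) a * (u i j)⁻¹`. -/
  β_comp : ∀ i j a, β i (β j a) =
    (↑(u i j)⁻¹ : RingMultiplier T).right ((u i j : RingMultiplier T).left (β (i + j) a))
  u_right_zero : ∀ i, u i 0 = 1
  u_left_zero : ∀ i, u 0 i = 1
  /-- `β i (a * u j k) * u i (j + k) = β i a * u i j * u (i + j) k`. -/
  cocycle : ∀ i j k a,
    (u i (j + k) : RingMultiplier T).right (β i ((u j k : RingMultiplier T).right a)) =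
      (u (i + j) k : RingMultiplier T).right ((u i j : RingMultiplier T).right (β i a))

namespace TwistedGlobalAction

variable {T : Type*} [NonUnitalRing T] (B : TwistedGlobalAction T)

/-- The coefficient of `(a x^i) (b x^j)`, namely `β_i (β_i⁻¹ (a) b) u_{i,j}`. -/
def monoMul (i j : ℤ) (a b : T) : T :=
  (B.u i j : RingMultiplier T).right (B.β i ((B.β i).symm a * b))

theorem monoMul_eq (i j : ℤ) (a b : T) :
    B.monoMul i j a b = a * (B.u i j : RingMultiplier T).right (B.β i b) := by
  simp [monoMul, RingMultiplier.right_mul]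

theorem β_comp_u (i j : ℤ) (a : T) :
    (B.u i j : RingMultiplier T).right (B.β i (B.β j a)) =
      (B.u i j : RingMultiplier T).left (B.β (i + j) a) := by
  rw [B.β_comp, ← RingMultiplier.mul_right', Units.inv_mul, RingMultiplier.one_right']

theorem monoMul_assoc (i j k : ℤ) (a b c : T) :
    B.monoMul (i + j) k (B.monoMul i j a b) c = B.monoMul i (j + k) a (B.monoMul j k b c) := by
  simp only [monoMul_eq]
  rw [← RingMultiplier.right_mul _ b, B.cocycle, map_mul, RingMultiplier.right_mul,
    RingMultiplier.right_mul, mul_assoc, B.β_comp_u, RingMultiplier.central,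
    ← RingMultiplier.central (B.u i j : RingMultiplier T) (B.β i b), ← RingMultiplier.right_mul,
    RingMultiplier.central, RingMultiplier.right_mul]

/-- The twisted skew power series ring `T[[x; β, u]]`, of all series `∑ a_n x^n` with `a_n ∈ T`. -/
def Series (_B : TwistedGlobalAction T) : Type _ := ℕ → T

instance : AddCommGroup B.Series := inferInstanceAs (AddCommGroup (ℕ → T))

variable {B}

/-- The `n`-th coefficient. -/
def Series.coeff (f : B.Series) (n : ℕ) : T := f n

/-- The series with the given coefficients. -/
def Series.mk (f : ℕ → T) : B.Series := f

theorem Series.ext {f g : B.Series} (h : ∀ n, f.coeff n = g.coeff n) : f = g := funext h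

@[simp] theorem Series.coeff_mk (f : ℕ → T) (n : ℕ) : (Series.mk f : B.Series).coeff n = f n := rfl

@[simp] theorem Series.coeff_add (f g : B.Series) (n : ℕ) :
    (f + g).coeff n = f.coeff n + g.coeff n := rfl

@[simp] theorem Series.coeff_zero (n : ℕ) : (0 : B.Series).coeff n = 0 := rfl

instance : Mul B.Series where
  mul f g := Series.mk fun n =>
    ∑ p ∈ Finset.HasAntidiagonal.antidiagonal n, B.monoMul p.1 p.2 (f.coeff p.1) (g.coeff p.2)

theorem Series.coeff_mul (f g : B.Series) (n : ℕ) : (f * g).coeff n =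
    ∑ p ∈ Finset.HasAntidiagonal.antidiagonal n, B.monoMul p.1 p.2 (f.coeff p.1) (g.coeff p.2) := rfl

instance : NonUnitalRing B.Series :=
  { (inferInstance : AddCommGroup B.Series) with
    mul := (· * ·)
    left_distrib := fun f g h => Series.ext fun n => by
      simp only [Series.coeff_mul, Series.coeff_add, monoMul_eq, map_add, mul_add,
        Finset.sum_add_distrib]
    right_distrib := fun f g h => Series.ext fun n => by
      simp only [Series.coeff_mul, Series.coeff_add, monoMul_eq, add_mul, Finset.sum_add_distrib]
    zero_mul := fun f => Series.ext fun n => by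
      simp [Series.coeff_mul, monoMul_eq]
    mul_zero := fun f => Series.ext fun n => by
      simp [Series.coeff_mul, monoMul_eq]
    mul_assoc := fun f g h => Series.ext fun n => by
      have hL : (f * g * h).coeff n = ∑ p ∈ Finset.HasAntidiagonal.antidiagonal n,
          ∑ q ∈ Finset.HasAntidiagonal.antidiagonal p.1, B.monoMul q.1 (q.2 + p.2) (f.coeff q.1)
            (B.monoMul q.2 p.2 (g.coeff q.2) (h.coeff p.2)) := by
        rw [Series.coeff_mul]
        refine Finset.sum_congr rfl fun p hp => ?_
        rw [monoMul_eq, Series.coeff_mul, Finset.sum_mul]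
        refine Finset.sum_congr rfl fun q hq => ?_
        rw [← B.monoMul_assoc, B.monoMul_eq (q.1 + q.2), ← Finset.HasAntidiagonal.mem_antidiagonal.1 hq,
          Nat.cast_add]
      have hR : (f * (g * h)).coeff n = ∑ p ∈ Finset.HasAntidiagonal.antidiagonal n,
          ∑ q ∈ Finset.HasAntidiagonal.antidiagonal p.2, B.monoMul p.1 (q.1 + q.2) (f.coeff p.1)
            (B.monoMul q.1 q.2 (g.coeff q.1) (h.coeff q.2)) := by
        rw [Series.coeff_mul]
        refine Finset.sum_congr rfl fun p hp => ?_
        rw [monoMul_eq, Series.coeff_mul, map_sum, map_sum, Finset.mul_sum]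
        refine Finset.sum_congr rfl fun q hq => ?_
        rw [B.monoMul_eq p.1, ← Finset.HasAntidiagonal.mem_antidiagonal.1 hq, Nat.cast_add]
      rw [hL, hR]
      simp only [Finset.sum_sigma']
      apply Finset.sum_nbij' (fun ⟨⟨_i, j⟩, ⟨k, l⟩⟩ ↦ ⟨(k, l + j), (l, j)⟩)
        (fun ⟨⟨i, _j⟩, ⟨k, l⟩⟩ ↦ ⟨(i + k, l), (i, k)⟩)
      · rintro ⟨⟨i, j⟩, ⟨k, l⟩⟩ hp
        simp only [Finset.mem_sigma, Finset.HasAntidiagonal.mem_antidiagonal] at hp ⊢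
        obtain ⟨h1, h2⟩ := hp
        constructor
        · omega
        · trivial
      · rintro ⟨⟨i, j⟩, ⟨k, l⟩⟩ hp
        simp only [Finset.mem_sigma, Finset.HasAntidiagonal.mem_antidiagonal] at hp ⊢
        obtain ⟨h1, h2⟩ := hp
        constructor
        · omega
        · trivial
      · rintro ⟨⟨i, j⟩, ⟨k, l⟩⟩ hp
        simp only [Finset.mem_sigma, Finset.HasAntidiagonal.mem_antidiagonal] at hp
        obtain ⟨h1, rfl⟩ := hp
        rfl
      · rintro ⟨⟨i, j⟩, ⟨k, l⟩⟩ hp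
        simp only [Finset.mem_sigma, Finset.HasAntidiagonal.mem_antidiagonal] at hp
        obtain ⟨h1, rfl⟩ := hp
        rfl
      · rintro ⟨⟨i, j⟩, ⟨k, l⟩⟩ hp
        rfl }

/-- The constant series `t x^0`. -/
def Series.const (B : TwistedGlobalAction T) (t : T) : B.Series :=
  Series.mk fun n => if n = 0 then t else 0

end TwistedGlobalAction

/-- The twisted global action `B` of `ℤ` on `T`, with the map `φ : R → T`, is an enveloping action of
the unital twisted partial action `A` of `ℤ` on `R`. -/
structure IsEnvelopingAction {R T : Type*} [Ring R] [NonUnitalRing T] (A : TwistedPartialAction R)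
    (B : TwistedGlobalAction T) (φ : R →ₙ+* T) : Prop where
  injective : Function.Injective φ
  mul_mem_range_left : ∀ t r, t * φ r ∈ Set.range φ
  mul_mem_range_right : ∀ t r, φ r * t ∈ Set.range φ
  sum_eq_top : ⨆ i : ℤ, (φ : R →+ T).range.map (B.β i : T →+ T) = ⊤
  image_D : ∀ i, φ '' (A.D i : Set R) = Set.range φ ∩ B.β i '' Set.range φ
  map_α : ∀ i (a : A.D (-i)), φ (A.α i a) = B.β i (φ a)
  map_mul_w : ∀ i j a, a ∈ A.D i → a ∈ A.D (i + j) →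
    φ (a * A.w i j) = (B.u i j : RingMultiplier T).right (φ a)
  map_w_mul : ∀ i j a, a ∈ A.D i → a ∈ A.D (i + j) →
    φ (A.w i j * a) = (B.u i j : RingMultiplier T).left (φ a)

namespace IsEnvelopingAction

variable {R T : Type*} [Ring R] [NonUnitalRing T] {A : TwistedPartialAction R}
  {B : TwistedGlobalAction T} {φ : R →ₙ+* T}

theorem map_monoMul (h : IsEnvelopingAction A B φ) {i j : ℤ} (a : A.D i) (b : A.D j) :
    φ (A.monoMul i j a b) = B.monoMul i j (φ a) (φ b) := by
  unfold TwistedPartialAction.monoMul TwistedGlobalAction.monoMul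
  have h1 : (B.β i).symm (φ a) = φ ((A.α i).symm a) := by
    rw [RingEquiv.symm_apply_eq, ← h.map_α, RingEquiv.apply_symm_apply]
  rw [h.map_mul_w i j _ (SetLike.coe_mem _) (A.α_mem ((A.D j).mul_mem_left _ _ b.2)), h.map_α, h1,
    map_mul]

/-- The inclusion `R[[x; α, w]] → T[[x; β, u]]`, `∑ a_n x^n ↦ ∑ φ(a_n) x^n`. -/
def seriesMap (h : IsEnvelopingAction A B φ) : A.Series →ₙ+* B.Series where
  toFun f := .mk fun n => φ (f.coeff n)
  map_zero' := TwistedGlobalAction.Series.ext fun n => by simp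
  map_add' f g := TwistedGlobalAction.Series.ext fun n => by simp
  map_mul' f g := TwistedGlobalAction.Series.ext fun n => by
    simp [TwistedGlobalAction.Series.coeff_mul, TwistedPartialAction.Series.coeff_mul,
      h.map_monoMul]

end IsEnvelopingAction

/-- A prime ideal of a (possibly non-commutative and non-unital) ring: a proper two-sided ideal `P`
such that `I J ⊆ P` implies `I ⊆ P` or `J ⊆ P` for all two-sided ideals `I`, `J`. -/
def TwoSidedIdeal.IsPrimeIdeal {S : Type*} [NonUnitalRing S] (P : TwoSidedIdeal S) : Prop :=
  P ≠ ⊤ ∧ ∀ I J : TwoSidedIdeal S, (∀ a ∈ I, ∀ b ∈ J, a * b ∈ P) → I ≤ P ∨ J ≤ P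

/-! Write `S` for `T[[x;β,u]]` and `e` for the constant series `φ(1)x^0`, an idempotent. The point
is that `R[[x;α,w]]` is exactly the corner `eSe`: the `n`-th coefficient of `ese` is `φ(1) s_n
β_n(φ(1))`, which lies in `φ(R) ∩ β_n(φ(R)) = φ(D_n)`, while `e` acts as an identity on the image of
`R[[x;α,w]]`. Moreover `R ⊆ P'` holds exactly when `e ∈ P'`, because `φ(r) = φ(r)φ(1)`.

It remains to prove the classical statement for a corner `C = eSe` (`bijOn_comap_corner`):
contraction is a bijection from the primes of `S` not containing `e` to the primes of `C`. The
inverse sends `P` to `{s | e(xsy)e ∈ P for all x, y}` (`cornerExtension`). Since `S` need not have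
an identity, the elementwise form of primeness, `aSb ⊆ P` implies `a ∈ P` or `b ∈ P`, needs its own
argument (`IsPrimeIdeal.mem_or_mem_of_forall_mul`). -/

/-! ### Elementwise primeness without identity, and extension of ideals from a corner. -/

namespace TwoSidedIdeal

variable {S : Type*} [NonUnitalRing S]

/-- Without an identity, `a` need not lie in the ideal spanned by the products `xay`, so the ideals
used are annihilators modulo `P`, which contain `a` and `b` by construction: `I = {x | xSb ⊆ P}`, `J
= {y | ISy ⊆ P}` and `K = {z | zJ ⊆ P}`. Primeness is applied to `KJ ⊆ P` and, if `K ⊆ P`, once more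
to the product of `I` with the whole ring. -/
theorem IsPrimeIdeal.mem_or_mem_of_forall_mul {P : TwoSidedIdeal S} (hP : P.IsPrimeIdeal) {a b : S}
    (hab : ∀ s, a * s * b ∈ P) : a ∈ P ∨ b ∈ P := by
  obtain ⟨htop, hprime⟩ := hP
  let I : TwoSidedIdeal S := .mk' {x | ∀ s, x * s * b ∈ P}
    (fun s => by simpa only [zero_mul] using P.zero_mem)
    (fun hx hy s => by simpa only [add_mul] using P.add_mem (hx s) (hy s))
    (fun hx s => by simpa only [neg_mul] using P.neg_mem (hx s))
    (fun {x y} hy s => by simpa only [mul_assoc] using P.mul_mem_left x _ (hy s))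
    (fun {x y} hx s => by simpa only [mul_assoc] using hx (y * s))
  have hI : ∀ x, x ∈ I ↔ ∀ s, x * s * b ∈ P := fun x => mem_mk' ..
  let J : TwoSidedIdeal S := .mk' {y | ∀ x ∈ I, ∀ s, x * s * y ∈ P}
    (fun x _ s => by simpa only [mul_zero] using P.zero_mem)
    (fun hx hy z hz s => by simpa only [mul_add] using P.add_mem (hx z hz s) (hy z hz s))
    (fun hx z hz s => by simpa only [mul_neg] using P.neg_mem (hx z hz s))
    (fun {x y} hy z hz s => by simpa only [mul_assoc] using hy z hz (s * x))
    (fun {x y} hx z hz s => by simpa only [mul_assoc] using P.mul_mem_right _ y (hx z hz s))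
  have hJ : ∀ y, y ∈ J ↔ ∀ x ∈ I, ∀ s, x * s * y ∈ P := fun y => mem_mk' ..
  let K : TwoSidedIdeal S := .mk' {z | ∀ y ∈ J, z * y ∈ P}
    (fun y _ => by simpa only [zero_mul] using P.zero_mem)
    (fun hx hy z hz => by simpa only [add_mul] using P.add_mem (hx z hz) (hy z hz))
    (fun hx z hz => by simpa only [neg_mul] using P.neg_mem (hx z hz))
    (fun {x y} hy z hz => by simpa only [mul_assoc] using P.mul_mem_left x _ (hy z hz))
    (fun {x y} hx z hz => by simpa only [mul_assoc] using hx _ (J.mul_mem_left y z hz))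
  have hK : ∀ z, z ∈ K ↔ ∀ y ∈ J, z * y ∈ P := fun z => mem_mk' ..
  rcases hprime K J fun z hz => (hK z).1 hz with hKP | hJP
  -- Here `IS ⊆ K ⊆ P` by the definition of `J`, and `P` is proper, so `I ⊆ P`.
  · rcases hprime I ⊤ fun x hx s _ => hKP ((hK _).2 fun y hy => (hJ y).1 hy x hx s) with h | h
    · exact .inl (h ((hI a).2 hab))
    · exact absurd (top_le_iff.1 h) htop
  · exact .inr (hJP ((hJ b).2 fun x hx => (hI x).1 hx))

variable {C : Type*} [NonUnitalRing C]

/-- The ideal of all `s` with `π (x * s * y) ∈ P` for all `x` and `y`. -/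
def cornerExtension (π : S →+ C) (P : TwoSidedIdeal C) : TwoSidedIdeal S :=
  .mk' {s | ∀ x y, π (x * s * y) ∈ P}
    (fun x y => by simpa only [mul_zero, zero_mul, map_zero] using P.zero_mem)
    (fun hs ht x y => by
      simpa only [mul_add, add_mul, map_add] using P.add_mem (hs x y) (ht x y))
    (fun hs x y => by simpa only [mul_neg, neg_mul, map_neg] using P.neg_mem (hs x y))
    (fun {t s} hs x y => by simpa only [mul_assoc] using hs (x * t) y)
    (fun {s t} hs x y => by simpa only [mul_assoc] using hs x (t * y))

theorem mem_cornerExtension {π : S →+ C} {P : TwoSidedIdeal C} {s : S} :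
    s ∈ cornerExtension π P ↔ ∀ x y, π (x * s * y) ∈ P :=
  mem_mk' ..

end TwoSidedIdeal

/-! ### Prime ideals of a corner `C = eSe`, with `e = ι 1` and `π(s) = ese`. -/

section Corner

open TwoSidedIdeal

variable {S C : Type*} [NonUnitalRing S] [Ring C] {ι : C →ₙ+* S} {π : S →+ C}

theorem map_one_mul_map (c : C) : ι 1 * ι c = ι c := by rw [← map_mul, one_mul]

theorem map_mul_map_one (c : C) : ι c * ι 1 = ι c := by rw [← map_mul, mul_one]

theorem proj_map (hι : Function.Injective ι) (hπ : ∀ s, ι (π s) = ι 1 * s * ι 1) (c : C) :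
    π (ι c) = c :=
  hι (by rw [hπ, map_one_mul_map, map_mul_map_one])

/-- Elements of the corner satisfy `c = ece`, so `e(xcy)e = (exe)c(eye)`. -/
theorem proj_mul_map_mul (hι : Function.Injective ι) (hπ : ∀ s, ι (π s) = ι 1 * s * ι 1)
    (x y : S) (c : C) : π (x * ι c * y) = π x * c * π y := by
  apply hι
  rw [hπ, map_mul ι, map_mul ι, hπ, hπ]
  conv_lhs => rw [← map_mul_map_one c, ← map_one_mul_map c]
  simp only [mul_assoc]

/-- For `a ∈ I` and `b ∈ J` in the corner, `asb = a(ese)b` with `a·π(s) ∈ I`. Hence `IJ` inside the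
contraction gives `aSb ⊆ P`, and elementwise primeness applies. -/
theorem TwoSidedIdeal.IsPrimeIdeal.comap_corner (hπ : ∀ s, ι (π s) = ι 1 * s * ι 1)
    {P : TwoSidedIdeal S} (hP : P.IsPrimeIdeal) (h1 : ι 1 ∉ P) : (P.comap ι).IsPrimeIdeal := by
  refine ⟨fun h => h1 ?_, fun I J hIJ => ?_⟩
  · rw [← mem_comap, h]
    trivial
  · by_contra! hcon
    obtain ⟨a, haI, haP⟩ := SetLike.not_le_iff_exists.1 hcon.1
    obtain ⟨b, hbJ, hbP⟩ := SetLike.not_le_iff_exists.1 hcon.2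
    rw [mem_comap] at haP hbP
    refine (hP.mem_or_mem_of_forall_mul fun s => ?_).elim haP hbP
    have := hIJ _ (I.mul_mem_right a (π s) haI) _ hbJ
    rw [mem_comap, map_mul, map_mul, hπ] at this
    rw [← map_mul_map_one a, ← map_one_mul_map b]
    simpa only [mul_assoc] using this

theorem comap_cornerExtension (hι : Function.Injective ι) (hπ : ∀ s, ι (π s) = ι 1 * s * ι 1)
    (P : TwoSidedIdeal C) : (cornerExtension π P).comap ι = P := by
  ext c
  simp only [mem_comap, mem_cornerExtension, proj_mul_map_mul hι hπ]
  refine ⟨fun h => ?_, fun h x y => P.mul_mem_right _ _ (P.mul_mem_left _ _ h)⟩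
  -- Taking `x = y = e` recovers `c` itself, since `ece = c`.
  simpa only [proj_map hι hπ, one_mul, mul_one] using h (ι 1) (ι 1)

theorem TwoSidedIdeal.IsPrimeIdeal.map_one_notMem_cornerExtension (hι : Function.Injective ι)
    (hπ : ∀ s, ι (π s) = ι 1 * s * ι 1) {P : TwoSidedIdeal C} (hP : P.IsPrimeIdeal) :
    ι 1 ∉ cornerExtension π P := fun h => hP.1 <| by
  rw [← mem_comap, comap_cornerExtension hι hπ] at h
  exact eq_top_iff.2 fun c _ => by simpa only [mul_one] using P.mul_mem_left c 1 h

/-- The extension of `P` is the largest ideal of `S` whose contraction lies in `P` (`key`): if `s ∈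
I`, then `e(xsy)e` lies in `I ∩ C`. A product of ideals inside the extension can therefore be tested
on contractions, where `P` is prime. -/
theorem TwoSidedIdeal.IsPrimeIdeal.cornerExtension (hι : Function.Injective ι)
    (hπ : ∀ s, ι (π s) = ι 1 * s * ι 1) {P : TwoSidedIdeal C} (hP : P.IsPrimeIdeal) :
    (cornerExtension π P).IsPrimeIdeal := by
  have key : ∀ I : TwoSidedIdeal S, I.comap ι ≤ P → I ≤ TwoSidedIdeal.cornerExtension π P :=
    fun I hI s hs => mem_cornerExtension.2 fun x y => hI <| by
      rw [mem_comap, hπ]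
      exact I.mul_mem_right _ _ (I.mul_mem_left _ _ (I.mul_mem_right _ _ (I.mul_mem_left _ _ hs)))
  refine ⟨fun h => hP.map_one_notMem_cornerExtension hι hπ (h ▸ trivial), fun I J hIJ => ?_⟩
  refine (hP.2 (I.comap ι) (J.comap ι) fun a ha b hb => ?_).imp (key I) (key J)
  rw [← comap_cornerExtension hι hπ P, mem_comap, map_mul]
  exact hIJ _ ((mem_comap ι).1 ha) _ ((mem_comap ι).1 hb)

theorem TwoSidedIdeal.IsPrimeIdeal.cornerExtension_comap (hπ : ∀ s, ι (π s) = ι 1 * s * ι 1)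
    {P : TwoSidedIdeal S} (hP : P.IsPrimeIdeal) (h1 : ι 1 ∉ P) :
    TwoSidedIdeal.cornerExtension π (P.comap ι) = P := by
  ext s
  simp only [mem_cornerExtension, mem_comap, hπ]
  refine ⟨fun h => ?_, fun h x y =>
    P.mul_mem_right _ _ (P.mul_mem_left _ _ (P.mul_mem_right _ _ (P.mul_mem_left _ _ h)))⟩
  -- From `exsye ∈ P` for all `x, y`, primeness strips both copies of `e ∉ P`: this line reduces `s
  -- ∈ P` to `sye ∈ P`, the next reduces that to `exsye ∈ P`.
  refine (hP.mem_or_mem_of_forall_mul fun y => ?_).resolve_right h1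
  refine (hP.mem_or_mem_of_forall_mul fun x => ?_).resolve_left h1
  simpa only [mul_assoc] using h x y

/-- Primes of a corner `C = e S e` of a ring `S` correspond to the primes of `S` without `e`. -/
theorem bijOn_comap_corner (hι : Function.Injective ι) (hπ : ∀ s, ι (π s) = ι 1 * s * ι 1) :
    Set.BijOn (fun P : TwoSidedIdeal S => P.comap ι) {P | P.IsPrimeIdeal ∧ ι 1 ∉ P}
      {P : TwoSidedIdeal C | P.IsPrimeIdeal} := by
  refine ⟨fun P hP => hP.1.comap_corner hπ hP.2, fun P hP Q hQ hPQ => ?_, fun P hP => ?_⟩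
  · rw [← hP.1.cornerExtension_comap hπ hP.2, ← hQ.1.cornerExtension_comap hπ hQ.2]
    exact congrArg _ hPQ
  · exact ⟨cornerExtension π P, ⟨IsPrimeIdeal.cornerExtension hι hπ hP,
      IsPrimeIdeal.map_one_notMem_cornerExtension hι hπ hP⟩, comap_cornerExtension hι hπ P⟩

end Corner

/-! ### Multiplication by constant series. -/

namespace TwistedGlobalAction

variable {T : Type*} [NonUnitalRing T] {B : TwistedGlobalAction T}

theorem Series.coeff_const_mul (t : T) (f : B.Series) (n : ℕ) :
    (Series.const B t * f).coeff n = t * f.coeff n := by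
  rw [Series.coeff_mul, Finset.sum_eq_single (0, n)]
  · simp [monoMul_eq, Series.const, B.u_left_zero, B.β_zero, RingMultiplier.one_right']
  · rintro ⟨i, j⟩ hp hne
    have : i ≠ 0 := by
      rintro rfl
      exact hne (by simpa using hp)
    simp [monoMul_eq, Series.const, this]
  · simp

/-- Moving the constant past `x^n` twists it by `β_n`, with trivial multiplier `u_{n,0} = 1`. This
twist is the source of `β_n(φ(R))`, hence of `D_n`, in the corner. -/
theorem Series.coeff_mul_const (t : T) (f : B.Series) (n : ℕ) :
    (f * Series.const B t).coeff n = f.coeff n * B.β n t := by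
  rw [Series.coeff_mul, Finset.sum_eq_single (n, 0)]
  · simp [monoMul_eq, Series.const, B.u_right_zero, RingMultiplier.one_right']
  · rintro ⟨i, j⟩ hp hne
    have : j ≠ 0 := by
      rintro rfl
      exact hne (by simpa using hp)
    simp [monoMul_eq, Series.const, this]
  · simp

end TwistedGlobalAction

/-! ### The partial power series ring as the corner `eSe`. -/

namespace IsEnvelopingAction

variable {R T : Type*} [Ring R] [NonUnitalRing T] {A : TwistedPartialAction R}
  {B : TwistedGlobalAction T} {φ : R →ₙ+* T}

theorem seriesMap_coeff (h : IsEnvelopingAction A B φ) (f : A.Series) (n : ℕ) :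
    (h.seriesMap f).coeff n = φ (f.coeff n) := rfl

theorem seriesMap_injective (h : IsEnvelopingAction A B φ) : Function.Injective h.seriesMap :=
  fun f g hfg => TwistedPartialAction.Series.ext fun n => h.injective <| by
    rw [← h.seriesMap_coeff, hfg, h.seriesMap_coeff]

theorem seriesMap_one (h : IsEnvelopingAction A B φ) :
    h.seriesMap 1 = TwistedGlobalAction.Series.const B (φ 1) :=
  TwistedGlobalAction.Series.ext fun n => by
    rw [seriesMap_coeff, TwistedPartialAction.Series.coeff_one, apply_ite φ, map_zero]
    rfl

/-- Both `φ(R)` and its image under `β_i` are ideals of `T`, so the product lies in their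
intersection, which is `φ(D_i)`. -/
theorem exists_mem_D_map_eq (h : IsEnvelopingAction A B φ) (t : T) (i : ℤ) :
    ∃ a ∈ A.D i, φ a = φ 1 * t * B.β i (φ 1) := by
  change _ ∈ φ '' (A.D i : Set R)
  rw [h.image_D]
  constructor
  · rw [mul_assoc]
    exact h.mul_mem_range_right _ _
  -- The element is `β_i` of `β_i⁻¹(φ(1)t)φ(1)`, which lies in `φ(R)`.
  · exact ⟨_, h.mul_mem_range_left ((B.β i).symm (φ 1 * t)) 1, by simp⟩

theorem exists_seriesMap_eq (h : IsEnvelopingAction A B φ) (s : B.Series) :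
    ∃ f, h.seriesMap f = h.seriesMap 1 * s * h.seriesMap 1 := by
  choose a ha hφ using fun n : ℕ => h.exists_mem_D_map_eq (s.coeff n) n
  refine ⟨.mk a ha, TwistedGlobalAction.Series.ext fun n => ?_⟩
  rw [seriesMap_coeff, TwistedPartialAction.Series.coeff_mk, hφ, seriesMap_one,
    TwistedGlobalAction.Series.coeff_mul_const, TwistedGlobalAction.Series.coeff_const_mul]

/-- The chosen preimages of `ese` depend additively on `s` because `seriesMap` is injective. -/
theorem exists_seriesProj (h : IsEnvelopingAction A B φ) :
    ∃ π : B.Series →+ A.Series, ∀ s, h.seriesMap (π s) = h.seriesMap 1 * s * h.seriesMap 1 := by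
  choose p hp using h.exists_seriesMap_eq
  refine ⟨AddMonoidHom.mk' p fun s t => h.seriesMap_injective ?_, hp⟩
  rw [map_add, hp, hp, hp, mul_add, add_mul]

/-- Turns the condition `R ⊆ P'` into the form `e ∈ P'` used for corners: the constant `φ(r)` is a
left multiple of `e`. -/
theorem forall_const_mem_iff (h : IsEnvelopingAction A B φ) (P : TwoSidedIdeal B.Series) :
    (∀ r : R, TwistedGlobalAction.Series.const B (φ r) ∈ P) ↔ h.seriesMap 1 ∈ P := by
  rw [seriesMap_one]
  refine ⟨fun hP => hP 1, fun hP r => ?_⟩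
  have : TwistedGlobalAction.Series.const B (φ r) =
      TwistedGlobalAction.Series.const B (φ r) * TwistedGlobalAction.Series.const B (φ 1) :=
    TwistedGlobalAction.Series.ext fun n => by
      rw [TwistedGlobalAction.Series.coeff_const_mul]
      by_cases hn : n = 0 <;> simp [TwistedGlobalAction.Series.const, hn, ← map_mul]
  rw [this]
  exact P.mul_mem_left _ _ hP

end IsEnvelopingAction

theorem mainTheorem11 {R T : Type*} [Ring R] [NonUnitalRing T] (A : TwistedPartialAction R)
    (B : TwistedGlobalAction T) (φ : R →ₙ+* T) (h : IsEnvelopingAction A B φ) :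
    Set.BijOn (fun P' : TwoSidedIdeal B.Series => P'.comap h.seriesMap)
      {P' | P'.IsPrimeIdeal ∧ ¬ ∀ r : R, TwistedGlobalAction.Series.const B (φ r) ∈ P'}
      {P : TwoSidedIdeal A.Series | P.IsPrimeIdeal} := by
  obtain ⟨π, hπ⟩ := h.exists_seriesProj
  simpa only [h.forall_const_mem_iff] using bijOn_comap_corner h.seriesMap_injective hπ
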